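/- Let $G$ be a locally compact (Hausdorff) abelian group whose Haar measure $\mu$ satisfies $\mu(G)<\infty$, let $1<p<\infty$, $\theta\ge 0$, and write $q'$ for the exponent conjugate to $q$, i.e. $\frac1q+\frac1{q'}=1$ (with $1'=\infty$). For a measurable function $g:G\to\mathbb R$ put $$\|g\|_{(p',\theta}=\inf_{g=\sum_{k=1}^\infty g_k}\ \sum_{k=1}^\infty\ \inf_{0<\varepsilon\le p-1}\varepsilon^{-\frac{\theta}{p-\varepsilon}}\,\|g_k\|_{L^{(p-\varepsilon)'}(\mu)},$$ where the outer infimum is over all decompositions $g=\sum_k g_k$ a.e. into measurable real-valued functions $g_k$, and let the small Lebesgue space $L^{(p',\theta}(G)$ consist of all (classes of) measurable $g$ with $\|g\|_{(p',\theta}<\infty$. Then $L^{(p',\theta}(G)$ admits an approximate identity bounded in $L^1(G)$: there are a net $(e_\alpha)_{\alpha\in I}$ in $L^{(p',\theta}(G)$, indexed by a nonempty directed set, and a constant $C<\infty$ such that $\|e_\alpha\|_{L^1(\mu)}\le C$ for all $\alpha\in I$ and, for every $f\in L^{(p',\theta}(G)$, the convolutions $e_\alpha*f$ are defined a.e. and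 belong to $L^{(p',\theta}(G)$, and $$\lim_{\alpha}\ \|e_\alpha*f-f\|_{(p',\theta}=0 .$$ -/

import Mathlib

open MeasureTheory Filter Topology
open scoped ENNReal NNReal

universe u

noncomputable section

/-- `inf_{0 < ε ≤ p - 1} ε ^ (-θ / (p - ε)) ‖g‖_{(p - ε)'}`, where `q'` is the exponent conjugate
to `q`. At `ε = p - 1` the exponent `(p - ε)'` is `∞` and the norm is the essential supremum. -/
def smallLebesgueGauge {Ω : Type*} [MeasurableSpace Ω] (p θ : ℝ) (μ : Measure Ω) (g : Ω → ℝ) :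
    ℝ≥0∞ :=
  ⨅ ε ∈ Set.Ioc (0 : ℝ) (p - 1),
    ENNReal.ofReal (ε ^ (-θ / (p - ε))) *
      eLpNorm g (ENNReal.conjExponent (ENNReal.ofReal (p - ε))) μ

/-- The (extended) norm of the small Lebesgue space `L^{(p',θ}(Ω, μ)`, `p' = p / (p - 1)`: the
infimum of `∑ₖ smallLebesgueGauge (gₖ)` over all decompositions `g = ∑ₖ gₖ` (almost everywhere)
into measurable real functions. On a finite measure space a decomposition whose sum of gauges is
finite converges absolutely almost everywhere, so the mode of convergence plays no role. -/
def smallLebesgueNorm {Ω : Type*} [MeasurableSpace Ω] (p θ : ℝ) (μ : Measure Ω) (g : Ω → ℝ) :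
    ℝ≥0∞ :=
  ⨅ (u : ℕ → Ω → ℝ) (_ : ∀ k, AEStronglyMeasurable (u k) μ)
    (_ : ∀ᵐ x ∂μ, HasSum (fun k => u k x) (g x)),
    ∑' k, smallLebesgueGauge p θ μ (u k)

/-- Membership in the small Lebesgue space `L^{(p',θ}(Ω, μ)`. -/
def MemSmallLebesgue {Ω : Type*} [MeasurableSpace Ω] (p θ : ℝ) (μ : Measure Ω) (g : Ω → ℝ) :
    Prop :=
  AEStronglyMeasurable g μ ∧ smallLebesgueNorm p θ μ g < ∞

/-- Convolution `(f * g)(x) = ∫ f(t) g(x - t) dμ(t)` of real functions on an additive group. -/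
def groupConv {G : Type*} [AddCommGroup G] [MeasurableSpace G] (μ : Measure G) (f g : G → ℝ) :
    G → ℝ :=
  convolution f g (ContinuousLinearMap.mul ℝ ℝ) μ

/-- The net `e` is an approximate identity of `L^{(p',θ}(G)` that is bounded in `L¹(G)`. -/
structure IsSmallLebesgueApproxIdentity {G : Type*} [AddCommGroup G] [MeasurableSpace G]
    (p θ : ℝ) (μ : Measure G) {I : Type*} [Preorder I] (e : I → G → ℝ) : Prop where
  mem : ∀ i, MemSmallLebesgue p θ μ (e i)
  bounded : ∃ C : ℝ≥0, ∀ i, eLpNorm (e i) 1 μ ≤ C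
  conv_exists : ∀ f, MemSmallLebesgue p θ μ f → ∀ i,
    ∀ᵐ x ∂μ, ConvolutionExistsAt (e i) f x (ContinuousLinearMap.mul ℝ ℝ) μ
  conv_mem : ∀ f, MemSmallLebesgue p θ μ f → ∀ i, MemSmallLebesgue p θ μ (groupConv μ (e i) f)
  tendsto : ∀ f, MemSmallLebesgue p θ μ f →
    Tendsto (fun i => smallLebesgueNorm p θ μ (groupConv μ (e i) f - f)) atTop (𝓝 0)

end

/-! ### Continuous densities on compact spaces -/

section Density

variable {X : Type*} [TopologicalSpace X] [CompactSpace X] [MeasurableSpace X] [BorelSpace X]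
  {μ : Measure X} [IsFiniteMeasure μ]

/-! A locally compact group of finite Haar measure is compact, so continuous probability densities
`e` with supports shrinking to `0` are available; being bounded, they and their convolutions with
integrable functions lie in the space. Convolution with `e` is a contraction of every `L^q`, `1 ≤ q
≤ ∞` (`eLpNorm_groupConv_le`), hence respects the gauge, whichever `ε` comes close to the infimum.
For `f = ∑ u k` of finite total gauge, `e * f - f = ∑ (e * u k - u k)` is an admissible
decomposition (`hasSum_groupConv`). Each term has gauge at most twice that of `u k`, and tends to
`0` because `u k` lies in some `L^q` with `q < ∞`, where continuous functions are dense. Dominated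
convergence for series concludes. -/

lemma Continuous.integrable_of_compactSpace {f : X → ℝ} (hf : Continuous f) :
    Integrable f μ :=
  hf.integrable_of_hasCompactSupport (HasCompactSupport.of_compactSpace f)

/-- Every neighbourhood of a point supports a continuous probability density. -/
theorem exists_continuous_density [T2Space X] [μ.IsOpenPosMeasure] {x : X} {V : Set X}
    (hV : V ∈ 𝓝 x) :
    ∃ e : X → ℝ, Continuous e ∧ 0 ≤ e ∧ ∫ t, e t ∂μ = 1 ∧ Function.support e ⊆ V := by
  obtain ⟨f, hf1, hf0, -, hf⟩ := exists_continuous_one_zero_of_isCompact (X := X)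
    (isCompact_singleton (x := x)) isOpen_interior.isClosed_compl
    (Set.disjoint_compl_right_iff_subset.2
      (Set.singleton_subset_iff.2 (mem_interior_iff_mem_nhds.2 hV)))
  have hpos : 0 < ∫ t, f t ∂μ :=
    f.continuous.integral_pos_of_hasCompactSupport_nonneg_nonzero
      (HasCompactSupport.of_compactSpace _) (fun t => (hf t).1)
      (x := x) (by rw [hf1 (Set.mem_singleton _)]; simp)
  refine ⟨fun t => (∫ s, f s ∂μ)⁻¹ * f t, by fun_prop,
    fun t => mul_nonneg (inv_nonneg.2 hpos.le) (hf t).1, ?_, fun t ht => ?_⟩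
  · rw [integral_const_mul, inv_mul_cancel₀ hpos.ne']
  · by_contra htV
    exact ht (by simp [hf0 (fun h => htV (interior_subset h) : t ∈ (interior V)ᶜ)])

end Density

/-! ### Convolution with a continuous probability density -/

section Convolution

variable {G : Type*} [AddCommGroup G] [TopologicalSpace G] [IsTopologicalAddGroup G]
  [MeasurableSpace G] [BorelSpace G] {μ : Measure G} {e u : G → ℝ}

lemma groupConv_eq_swap [μ.IsAddLeftInvariant] [μ.IsNegInvariant] (e u : G → ℝ) (x : G) :
    groupConv μ e u x = ∫ t, e (x - t) * u t ∂μ :=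
  convolution_eq_swap _

variable [CompactSpace G]

lemma continuous_groupConv [μ.IsAddLeftInvariant] [μ.IsNegInvariant] (he : Continuous e)
    (hu : Integrable u μ) : Continuous (groupConv μ e u) :=
  (HasCompactSupport.of_compactSpace e).continuous_convolution_left _ he hu.locallyIntegrable

lemma convolutionExists_of_continuous [μ.IsAddLeftInvariant] [μ.IsNegInvariant]
    (he : Continuous e) (hu : Integrable u μ) :
    ConvolutionExists e u (ContinuousLinearMap.mul ℝ ℝ) μ :=
  (HasCompactSupport.of_compactSpace e).convolutionExists_left _ he hu.locallyIntegrable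

lemma integrable_mul_comp_sub (he : Continuous e) (hu : Integrable u μ) (x : G) :
    Integrable (fun t => e (x - t) * u t) μ := by
  have hc : Continuous fun t => e (x - t) := by fun_prop
  obtain ⟨C, hC⟩ := isCompact_univ.exists_bound_of_continuousOn hc.continuousOn
  exact hu.bdd_mul hc.aestronglyMeasurable (ae_of_all _ fun t => hC t (Set.mem_univ t))

variable [IsFiniteMeasure μ]

lemma isProbabilityMeasure_withDensity_comp_sub [μ.IsAddLeftInvariant] [μ.IsNegInvariant]
    (he : Continuous e) (he0 : 0 ≤ e) (he1 : ∫ t, e t ∂μ = 1) (x : G) :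
    IsProbabilityMeasure (μ.withDensity fun t => ENNReal.ofReal (e (x - t))) := by
  have hc : Continuous fun t => e (x - t) := by fun_prop
  refine ⟨?_⟩
  rw [withDensity_apply _ MeasurableSet.univ, Measure.restrict_univ,
    ← ofReal_integral_eq_lintegral_ofReal hc.integrable_of_compactSpace
      (ae_of_all _ fun t => he0 (x - t)), integral_sub_left_eq_self e μ x, he1, ENNReal.ofReal_one]

/-- Jensen's inequality: `e (x - ·) μ` is a probability measure, so its `L¹` norm is at most its
`L^q` norm. -/
lemma enorm_groupConv_le [μ.IsAddLeftInvariant] [μ.IsNegInvariant]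
    (he : Continuous e) (he0 : 0 ≤ e) (he1 : ∫ t, e t ∂μ = 1)
    (hu : AEStronglyMeasurable u μ) {q : ℝ≥0∞} (hq : 1 ≤ q) (x : G) :
    ‖groupConv μ e u x‖ₑ ≤
      eLpNorm u q (μ.withDensity fun t => ENNReal.ofReal (e (x - t))) := by
  have hc : Continuous fun t => e (x - t) := by fun_prop
  have := isProbabilityMeasure_withDensity_comp_sub he he0 he1 x
  refine le_trans ?_ (eLpNorm_le_eLpNorm_of_exponent_le hq
    (hu.mono_ac (withDensity_absolutelyContinuous _ _)))
  rw [groupConv_eq_swap, eLpNorm_one_eq_lintegral_enorm,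
    lintegral_withDensity_eq_lintegral_mul₀ hc.measurable.ennreal_ofReal.aemeasurable]
  · refine (enorm_integral_le_lintegral_enorm _).trans (lintegral_mono fun t => ?_)
    simp [enorm_mul, Real.enorm_of_nonneg (he0 _)]
  · exact hu.enorm

/-- Convolution with a continuous probability density is a contraction of `L^q`. -/
theorem eLpNorm_groupConv_le [μ.IsAddLeftInvariant] [μ.IsNegInvariant]
    (he : Continuous e) (he0 : 0 ≤ e) (he1 : ∫ t, e t ∂μ = 1)
    (hu : AEStronglyMeasurable u μ) {q : ℝ≥0∞} (hq : 1 ≤ q) :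
    eLpNorm (groupConv μ e u) q μ ≤ eLpNorm u q μ := by
  obtain rfl | hqt := eq_or_ne q ∞
  · rw [eLpNorm_exponent_top]
    refine eLpNormEssSup_le_of_ae_enorm_bound (ae_of_all _ fun x => ?_)
    refine (enorm_groupConv_le he he0 he1 hu hq x).trans ?_
    rw [eLpNorm_exponent_top, eLpNorm_exponent_top]
    exact eLpNormEssSup_mono_measure u (withDensity_absolutelyContinuous _ _)
  obtain hut | hut := eq_or_ne (eLpNorm u q μ) ∞
  · simp [hut]
  have hq0 : q ≠ 0 := (zero_lt_one.trans_le hq).ne'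
  have hr : 0 < q.toReal := ENNReal.toReal_pos hq0 hqt
  -- The order of integration has to be exchanged, but `G` need not be second countable, so `(x, t)
  -- ↦ e (x - t)` may fail to be measurable for the product σ-algebra. Moving `|u|^q` into a finite
  -- measure leaves a continuous integrand of compact support, for which the exchange is valid.
  set w : G → ℝ≥0∞ := fun t => ‖u t‖ₑ ^ q.toReal
  have hw : AEMeasurable w μ := hu.enorm.pow_const _
  have hwt : ∫⁻ t, w t ∂μ ≠ ∞ :=
    (lintegral_rpow_enorm_lt_top_of_eLpNorm_lt_top hq0 hqt hut.lt_top).ne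
  have : IsFiniteMeasure (μ.withDensity w) := isFiniteMeasure_withDensity hwt
  have hc2 : Continuous (Function.uncurry fun x t : G => e (x - t)) := by
    simp only [Function.uncurry_def]; fun_prop
  have hcont : Continuous fun x => ∫ t, e (x - t) ∂(μ.withDensity w) := by
    rw [← continuousOn_univ]
    exact continuousOn_integral_of_compact_support isCompact_univ hc2.continuousOn
      (fun p x _ hx => absurd (Set.mem_univ x) hx)
  have key (x : G) : ‖groupConv μ e u x‖ₑ ^ q.toReal ≤
      ENNReal.ofReal (∫ t, e (x - t) ∂(μ.withDensity w)) := by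
    have hc : Continuous fun t => e (x - t) := by fun_prop
    have h := ENNReal.rpow_le_rpow (enorm_groupConv_le he he0 he1 hu hq x) hr.le
    refine h.trans_eq ?_
    rw [eLpNorm_eq_lintegral_rpow_enorm_toReal hq0 hqt, ← ENNReal.rpow_mul,
      one_div_mul_cancel hr.ne', ENNReal.rpow_one,
      ofReal_integral_eq_lintegral_ofReal hc.integrable_of_compactSpace
      (ae_of_all _ fun t => he0 (x - t)),
      lintegral_withDensity_eq_lintegral_mul₀ hc.measurable.ennreal_ofReal.aemeasurable hw,
      lintegral_withDensity_eq_lintegral_mul₀ hw hc.measurable.ennreal_ofReal.aemeasurable]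
    simp only [Pi.mul_apply, mul_comm, w]
  rw [eLpNorm_eq_lintegral_rpow_enorm_toReal hq0 hqt,
    eLpNorm_eq_lintegral_rpow_enorm_toReal hq0 hqt]
  refine ENNReal.rpow_le_rpow ((lintegral_mono key).trans ?_) (by positivity)
  rw [← ofReal_integral_eq_lintegral_ofReal hcont.integrable_of_compactSpace
      (ae_of_all _ fun x => integral_nonneg fun t => he0 (x - t)),
    integral_integral_swap_of_hasCompactSupport hc2 (HasCompactSupport.of_compactSpace _)]
  simp only [integral_sub_right_eq_self e, he1, integral_const, smul_eq_mul, mul_one]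
  rw [ofReal_measureReal, withDensity_apply _ MeasurableSet.univ, Measure.restrict_univ]

/-- A continuous probability density whose support is close to `0` moves an `L^q` function by
little under convolution. -/
theorem exists_nhds_eLpNorm_groupConv_sub_le [T2Space G] [μ.IsAddLeftInvariant] [μ.IsNegInvariant]
    [μ.Regular] (hu : AEStronglyMeasurable u μ) {q : ℝ≥0∞} (hq : 1 ≤ q) (hqt : q ≠ ∞)
    (hut : eLpNorm u q μ ≠ ∞) {δ : ℝ≥0∞} (hδ : δ ≠ 0) :
    ∃ V ∈ 𝓝 (0 : G), ∀ e : G → ℝ, Continuous e → 0 ≤ e → ∫ t, e t ∂μ = 1 →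
      Function.support e ⊆ V → eLpNorm (groupConv μ e u - u) q μ ≤ δ := by
  have hδ3 : δ / 3 ≠ 0 := by simp [hδ]
  obtain ⟨φ, hφ, hφc⟩ : ∃ φ : G → ℝ, eLpNorm (u - φ) q μ ≤ δ / 3 ∧ Continuous φ := by
    obtain ⟨φ, hφ, -⟩ := MemLp.exists_boundedContinuous_eLpNorm_sub_le hqt
      (⟨hu, hut.lt_top⟩ : MemLp u q μ) hδ3
    exact ⟨φ, hφ, φ.continuous⟩
  have huint : Integrable u μ := MemLp.integrable hq ⟨hu, hut.lt_top⟩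
  have hφint : Integrable φ μ := hφc.integrable_of_compactSpace
  -- A uniform bound `c` costs `μ(G)^(1/q) c` in `L^q`; `c` is the uniform continuity tolerance for
  -- `φ`.
  obtain ⟨c, hc0, hc⟩ : ∃ c : ℝ, 0 < c ∧ μ Set.univ ^ q.toReal⁻¹ * ENNReal.ofReal c ≤ δ / 3 := by
    have hm : μ Set.univ ^ q.toReal⁻¹ ≠ ∞ :=
      ENNReal.rpow_ne_top_of_nonneg (by positivity) (measure_ne_top _ _)
    have ht : Tendsto (fun c : ℝ => μ Set.univ ^ q.toReal⁻¹ * ENNReal.ofReal c) (𝓝[>] 0)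
        (𝓝 0) := by
      have := ENNReal.Tendsto.const_mul (a := μ Set.univ ^ q.toReal⁻¹)
        (ENNReal.tendsto_ofReal (tendsto_id (x := 𝓝 (0 : ℝ)))) (Or.inr hm)
      simpa using this.mono_left nhdsWithin_le_nhds
    obtain ⟨c, h1, h2⟩ := ((ht.eventually_lt_const (pos_iff_ne_zero.2 hδ3)).and
      self_mem_nhdsWithin).exists
    exact ⟨c, h2, h1.le⟩
  have hV : ∀ᶠ t in 𝓝 (0 : G), ∀ x ∈ (Set.univ : Set G), ‖φ (x - t) - φ x‖ ≤ c := by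
    refine isCompact_univ.eventually_forall_of_forall_eventually fun x _ => ?_
    have : Continuous fun z : G × G => ‖φ (z.2 - z.1) - φ z.2‖ := by fun_prop
    refine (this.tendsto (0, x)).eventually_le_const (by simpa using hc0)
  refine ⟨_, hV, fun e he he0 he1 hes => ?_⟩
  have hsplit : groupConv μ e u - u
      = groupConv μ e (u - φ) + (groupConv μ e φ - φ) + (φ - u) := by
    ext x
    have h : groupConv μ e (u - φ) x = groupConv μ e u x - groupConv μ e φ x := by
      simp only [groupConv_eq_swap, Pi.sub_apply, mul_sub]
      exact integral_sub (integrable_mul_comp_sub he huint x) (integrable_mul_comp_sub he hφint x)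
    simp [h]
  have h2 : eLpNorm (groupConv μ e φ - φ) q μ ≤ δ / 3 := by
    refine (eLpNorm_le_of_ae_bound (C := c) (ae_of_all _ fun x => ?_)).trans hc
    have h1 : φ x = ∫ t, e t * φ x ∂μ := by rw [integral_mul_const, he1, one_mul]
    have hi : Integrable (fun t => e t * φ (x - t)) μ :=
      Continuous.integrable_of_compactSpace (by fun_prop)
    have hi' : Integrable (fun t => e t * φ x) μ :=
      Continuous.integrable_of_compactSpace (by fun_prop)
    have h3 : (groupConv μ e φ - φ) x = ∫ t, e t * (φ (x - t) - φ x) ∂μ := by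
      simp only [mul_sub]
      rw [integral_sub hi hi', ← h1]
      rfl
    rw [h3]
    calc ‖∫ t, e t * (φ (x - t) - φ x) ∂μ‖ ≤ ∫ t, e t * c ∂μ := by
          refine norm_integral_le_of_norm_le
            (Continuous.integrable_of_compactSpace (by fun_prop)) (ae_of_all _ fun t => ?_)
          rw [norm_mul, Real.norm_of_nonneg (he0 t)]
          by_cases ht : e t = 0
          · simp [ht]
          · exact mul_le_mul_of_nonneg_left (hes ht x (Set.mem_univ x)) (he0 t)
      _ = c := by rw [integral_mul_const, he1, one_mul]
  have hm1 := (continuous_groupConv he (huint.sub hφint)).aestronglyMeasurable (μ := μ)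
  have hm2 := (continuous_groupConv he hφint).aestronglyMeasurable (μ := μ)
  have hm3 := hφc.aestronglyMeasurable (μ := μ)
  calc eLpNorm (groupConv μ e u - u) q μ
      ≤ eLpNorm (groupConv μ e (u - φ)) q μ + eLpNorm (groupConv μ e φ - φ) q μ
        + eLpNorm (φ - u) q μ := by
        rw [hsplit]
        refine (eLpNorm_add_le (hm1.add (hm2.sub hm3)) (hm3.sub hu) hq).trans ?_
        gcongr
        exact eLpNorm_add_le hm1 (hm2.sub hm3) hq
    _ ≤ δ / 3 + δ / 3 + δ / 3 := by
        gcongr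
        · exact (eLpNorm_groupConv_le he he0 he1 (hu.sub hm3) hq).trans hφ
        · rwa [eLpNorm_sub_comm]
    _ = δ := ENNReal.add_thirds δ

end Convolution

/-! ### The gauge and the norm of the small Lebesgue space -/

/-- Dominated convergence for series holds along an arbitrary filter, hence along nets. -/
lemma ENNReal.tendsto_tsum_zero_of_dominated {ι κ : Type*} {l : Filter ι} {f : ι → κ → ℝ≥0∞}
    {b : κ → ℝ≥0∞} (hb : ∑' k, b k ≠ ∞) (hfb : ∀ i k, f i k ≤ b k)
    (hf : ∀ k, Tendsto (fun i => f i k) l (𝓝 0)) :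
    Tendsto (fun i => ∑' k, f i k) l (𝓝 0) := by
  have hbk : ∀ k, b k ≠ ∞ := ENNReal.ne_top_of_tsum_ne_top hb
  have hfk : ∀ i k, f i k ≠ ∞ := fun i k => ne_top_of_le_ne_top (hbk k) (hfb i k)
  have h := tendsto_tsum_of_dominated_convergence (𝓕 := l) (f := fun i k => (f i k).toReal)
    (g := fun _ => (0 : ℝ)) (ENNReal.summable_toReal hb)
    (fun k => by
      simpa [Function.comp_def] using (ENNReal.tendsto_toReal ENNReal.zero_ne_top).comp (hf k))
    (Eventually.of_forall fun i k => by
      rw [Real.norm_of_nonneg ENNReal.toReal_nonneg]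
      exact ENNReal.toReal_mono (hbk k) (hfb i k))
  simp only [tsum_zero] at h
  have h' := ENNReal.tendsto_ofReal h
  rw [ENNReal.ofReal_zero] at h'
  refine h'.congr fun i => ?_
  rw [← ENNReal.tsum_toReal_eq (hfk i), ENNReal.ofReal_toReal]
  exact ne_top_of_le_ne_top hb (ENNReal.tsum_le_tsum (hfb i))

lemma ENNReal.one_le_conjExponent (q : ℝ≥0∞) : 1 ≤ ENNReal.conjExponent q := le_self_add

section Gauge

variable {Ω : Type*} [MeasurableSpace Ω] {μ : Measure Ω} {p θ : ℝ} {g : Ω → ℝ}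

lemma smallLebesgueGauge_le {ε : ℝ} (hε : ε ∈ Set.Ioc 0 (p - 1)) :
    smallLebesgueGauge p θ μ g ≤ ENNReal.ofReal (ε ^ (-θ / (p - ε))) *
      eLpNorm g (ENNReal.conjExponent (ENNReal.ofReal (p - ε))) μ :=
  iInf₂_le ε hε

/-- A constant uniform in `q` passes through the infimum over `ε`. -/
lemma smallLebesgueGauge_le_const_mul {v : Ω → ℝ} {c : ℝ≥0∞} (hc0 : c ≠ 0) (hc : c ≠ ∞)
    (h : ∀ q, 1 ≤ q → eLpNorm v q μ ≤ c * eLpNorm g q μ) :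
    smallLebesgueGauge p θ μ v ≤ c * smallLebesgueGauge p θ μ g := by
  rw [← ENNReal.inv_mul_le_iff hc0 hc]
  refine le_iInf₂ fun ε hε => ?_
  rw [ENNReal.inv_mul_le_iff hc0 hc, mul_left_comm]
  exact (smallLebesgueGauge_le hε).trans (by gcongr; exact h _ (ENNReal.one_le_conjExponent _))

lemma smallLebesgueGauge_zero (hp : 1 < p) : smallLebesgueGauge p θ μ (fun _ => 0) = 0 := by
  refine le_antisymm ((smallLebesgueGauge_le (ε := p - 1) ⟨by linarith, le_rfl⟩).trans ?_)
    zero_le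
  simp

/-- The weight in the gauge is bounded below by `p ^ (-θ)`. -/
lemma rpow_neg_le_weight (hp : 1 < p) (hθ : 0 ≤ θ) {ε : ℝ} (hε : ε ∈ Set.Ioc 0 (p - 1)) :
    p ^ (-θ) ≤ ε ^ (-θ / (p - ε)) := by
  obtain ⟨h0, h1⟩ := hε
  have hd : 1 ≤ p - ε := by linarith
  have ha : θ / (p - ε) ≤ θ := div_le_self hθ hd
  have ha0 : 0 ≤ θ / (p - ε) := div_nonneg hθ (by linarith)
  rw [neg_div]
  calc p ^ (-θ) ≤ p ^ (-(θ / (p - ε))) := Real.rpow_le_rpow_of_exponent_le hp.le (by linarith)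
    _ ≤ ε ^ (-(θ / (p - ε))) := Real.rpow_le_rpow_of_nonpos h0 (by linarith) (by linarith)

/-- On a finite measure space the gauge dominates the `L¹` norm. -/
theorem exists_eLpNorm_one_le_smallLebesgueGauge [IsFiniteMeasure μ] (hp : 1 < p) (hθ : 0 ≤ θ) :
    ∃ K : ℝ≥0∞, K ≠ ∞ ∧ ∀ g : Ω → ℝ, AEStronglyMeasurable g μ →
      eLpNorm g 1 μ ≤ K * smallLebesgueGauge p θ μ g := by
  have hp0 : 0 < p := by linarith
  have hpθ : 0 < p ^ θ := Real.rpow_pos_of_pos hp0 θ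
  -- The embedding of `L^q` in `L¹` costs `μ(Ω)^(1 - 1/q)`, at most `M` for every `q ≥ 1`; the
  -- factor `p ^ θ` absorbs the weight.
  set M := max 1 (μ Set.univ)
  have hM1 : 1 ≤ M := le_max_left _ _
  have hMt : M ≠ ∞ := by simp [M]
  have hM0 : M ≠ 0 := (zero_lt_one.trans_le hM1).ne'
  have hK0 : ENNReal.ofReal (p ^ θ) * M ≠ 0 := mul_ne_zero (by simpa using hpθ) hM0
  have hKt : ENNReal.ofReal (p ^ θ) * M ≠ ∞ := ENNReal.mul_ne_top ENNReal.ofReal_ne_top hMt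
  refine ⟨ENNReal.ofReal (p ^ θ) * M, hKt, fun g hg => ?_⟩
  rw [← ENNReal.inv_mul_le_iff hK0 hKt]
  refine le_iInf₂ fun ε hε => ?_
  rw [ENNReal.inv_mul_le_iff hK0 hKt]
  set q := ENNReal.conjExponent (ENNReal.ofReal (p - ε))
  have hq : 1 ≤ q := ENNReal.one_le_conjExponent _
  have h1 : eLpNorm g 1 μ ≤ eLpNorm g q μ * M := by
    refine (eLpNorm_le_eLpNorm_mul_rpow_measure_univ hq hg).trans ?_
    gcongr
    have hs0 : 0 ≤ 1 / (1 : ℝ≥0∞).toReal - 1 / q.toReal := by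
      obtain h | h := eq_or_ne q ∞
      · simp [h]
      · have : 1 ≤ q.toReal := by simpa using ENNReal.toReal_mono h hq
        simpa using inv_le_one_of_one_le₀ this
    have hs1 : 1 / (1 : ℝ≥0∞).toReal - 1 / q.toReal ≤ 1 := by simp
    calc μ Set.univ ^ (1 / (1 : ℝ≥0∞).toReal - 1 / q.toReal)
        ≤ M ^ (1 / (1 : ℝ≥0∞).toReal - 1 / q.toReal) :=
          ENNReal.rpow_le_rpow (le_max_right _ _) hs0
      _ ≤ M ^ (1 : ℝ) := ENNReal.rpow_le_rpow_of_exponent_le hM1 hs1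
      _ = M := ENNReal.rpow_one M
  have h2 : 1 ≤ ENNReal.ofReal (p ^ θ) * ENNReal.ofReal (ε ^ (-θ / (p - ε))) := by
    rw [← ENNReal.ofReal_mul hpθ.le, ENNReal.one_le_ofReal]
    calc (1 : ℝ) = p ^ θ * p ^ (-θ) := by rw [← Real.rpow_add hp0]; simp
      _ ≤ _ := mul_le_mul_of_nonneg_left (rpow_neg_le_weight hp hθ hε) hpθ.le
  calc eLpNorm g 1 μ ≤ 1 * (eLpNorm g q μ * M) := by rwa [one_mul]
    _ ≤ (ENNReal.ofReal (p ^ θ) * ENNReal.ofReal (ε ^ (-θ / (p - ε)))) * (eLpNorm g q μ * M) := by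
        gcongr
    _ = _ := by ring

/-- A function of finite gauge lies in `L^{(p - ε)'}` for some `ε` with `(p - ε)' < ∞`. -/
lemma exists_eLpNorm_ne_top_of_smallLebesgueGauge_ne_top [IsFiniteMeasure μ] (hp : 1 < p)
    (hg : AEStronglyMeasurable g μ) (hgt : smallLebesgueGauge p θ μ g ≠ ∞) :
    ∃ ε ∈ Set.Ioc 0 (p - 1), ENNReal.conjExponent (ENNReal.ofReal (p - ε)) ≠ ∞ ∧
      eLpNorm g (ENNReal.conjExponent (ENNReal.ofReal (p - ε))) μ ≠ ∞ := by
  obtain ⟨ε, hε, h⟩ : ∃ ε ∈ Set.Ioc 0 (p - 1), ENNReal.ofReal (ε ^ (-θ / (p - ε))) *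
      eLpNorm g (ENNReal.conjExponent (ENNReal.ofReal (p - ε))) μ < ∞ := by
    simpa only [smallLebesgueGauge, iInf_lt_iff, exists_prop] using hgt.lt_top
  have hw : ENNReal.ofReal (ε ^ (-θ / (p - ε))) ≠ 0 := by
    simpa using Real.rpow_pos_of_pos hε.1 _
  have hgε := (ENNReal.lt_top_of_mul_ne_top_right h.ne hw).ne
  -- Only `ε = p - 1` gives the exponent `∞`. Decreasing `ε` lowers the conjugate exponent, which
  -- keeps the norm finite on a finite measure space.
  have hmin : 0 < min ε ((p - 1) / 2) := lt_min hε.1 (by linarith)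
  have hle : min ε ((p - 1) / 2) ≤ (p - 1) / 2 := min_le_right _ _
  refine ⟨min ε ((p - 1) / 2), ⟨hmin, (min_le_left _ _).trans hε.2⟩, ?_, ?_⟩
  · refine ENNReal.add_ne_top.2 ⟨ENNReal.one_ne_top, ENNReal.inv_ne_top.2 ?_⟩
    rw [← pos_iff_ne_zero, tsub_pos_iff_lt, ENNReal.one_lt_ofReal]
    linarith
  · refine (MemLp.mono_exponent ⟨hg, hgε.lt_top⟩ ?_).2.ne
    unfold ENNReal.conjExponent
    gcongr
    exact min_le_left _ _

lemma smallLebesgueNorm_le_tsum {u : ℕ → Ω → ℝ} (hu : ∀ k, AEStronglyMeasurable (u k) μ)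
    (hsum : ∀ᵐ x ∂μ, HasSum (fun k => u k x) (g x)) :
    smallLebesgueNorm p θ μ g ≤ ∑' k, smallLebesgueGauge p θ μ (u k) :=
  iInf_le_of_le u (iInf₂_le hu hsum)

lemma MemSmallLebesgue.exists_decomposition (hg : MemSmallLebesgue p θ μ g) :
    ∃ u : ℕ → Ω → ℝ, (∀ k, AEStronglyMeasurable (u k) μ) ∧
      (∀ᵐ x ∂μ, HasSum (fun k => u k x) (g x)) ∧
      ∑' k, smallLebesgueGauge p θ μ (u k) ≠ ∞ := by
  obtain ⟨u, hu, hs, h⟩ : ∃ u : ℕ → Ω → ℝ, ∃ _ : ∀ k, AEStronglyMeasurable (u k) μ,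
      ∃ _ : ∀ᵐ x ∂μ, HasSum (fun k => u k x) (g x),
      ∑' k, smallLebesgueGauge p θ μ (u k) < ∞ := by
    simpa only [smallLebesgueNorm, iInf_lt_iff] using hg.2
  exact ⟨u, hu, hs, h.ne⟩

lemma smallLebesgueNorm_le_gauge (hp : 1 < p) (hg : AEStronglyMeasurable g μ) :
    smallLebesgueNorm p θ μ g ≤ smallLebesgueGauge p θ μ g := by
  refine (smallLebesgueNorm_le_tsum (u := fun k => if k = 0 then g else fun _ => 0)
    (fun k => ?_) (ae_of_all _ fun x => ?_)).trans_eq ?_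
  · split_ifs
    exacts [hg, aestronglyMeasurable_const]
  · convert hasSum_ite_eq 0 (g x) using 2 with k
    split_ifs <;> rfl
  · rw [tsum_eq_single 0 fun k hk => by simp [hk, smallLebesgueGauge_zero hp]]
    simp

lemma memSmallLebesgue_of_bounded [IsFiniteMeasure μ] (hp : 1 < p)
    (hg : AEStronglyMeasurable g μ) {C : ℝ} (hC : ∀ x, ‖g x‖ ≤ C) :
    MemSmallLebesgue p θ μ g := by
  refine ⟨hg, (smallLebesgueNorm_le_gauge hp hg).trans_lt ?_⟩
  refine (smallLebesgueGauge_le (ε := p - 1) ⟨by linarith, le_rfl⟩).trans_lt ?_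
  refine ENNReal.mul_lt_top ENNReal.ofReal_lt_top
    ((eLpNorm_le_of_ae_bound (ae_of_all _ hC)).trans_lt ?_)
  exact ENNReal.mul_lt_top (ENNReal.rpow_lt_top_of_nonneg (by positivity) (measure_ne_top _ _))
    ENNReal.ofReal_lt_top

lemma Continuous.memSmallLebesgue [TopologicalSpace Ω] [CompactSpace Ω] [BorelSpace Ω]
    [IsFiniteMeasure μ] (hp : 1 < p) (hg : Continuous g) : MemSmallLebesgue p θ μ g := by
  obtain ⟨C, hC⟩ := isCompact_univ.exists_bound_of_continuousOn hg.continuousOn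
  exact memSmallLebesgue_of_bounded hp hg.aestronglyMeasurable fun x => hC x (Set.mem_univ x)

/-- A decomposition of finite total gauge has finite total `L¹` norm. -/
lemma tsum_eLpNorm_one_ne_top [IsFiniteMeasure μ] (hp : 1 < p) (hθ : 0 ≤ θ) {u : ℕ → Ω → ℝ}
    (hu : ∀ k, AEStronglyMeasurable (u k) μ)
    (hut : ∑' k, smallLebesgueGauge p θ μ (u k) ≠ ∞) : ∑' k, eLpNorm (u k) 1 μ ≠ ∞ := by
  obtain ⟨K, hK, h⟩ := exists_eLpNorm_one_le_smallLebesgueGauge (μ := μ) hp hθ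
  refine ne_top_of_le_ne_top (ENNReal.mul_ne_top hK hut) ?_
  rw [← ENNReal.tsum_mul_left]
  exact ENNReal.tsum_le_tsum fun k => h _ (hu k)

lemma MemSmallLebesgue.integrable [IsFiniteMeasure μ] (hp : 1 < p) (hθ : 0 ≤ θ)
    (hg : MemSmallLebesgue p θ μ g) : Integrable g μ := by
  obtain ⟨u, hu, hs, hut⟩ := hg.exists_decomposition
  refine ⟨hg.1, ?_⟩
  have h := tsum_eLpNorm_one_ne_top hp hθ hu hut
  simp only [eLpNorm_one_eq_lintegral_enorm] at h
  rw [← lintegral_tsum fun k => (hu k).enorm] at h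
  refine (lintegral_mono_ae ?_).trans_lt h.lt_top
  filter_upwards [hs] with x hx
  rw [← hx.tsum_eq]
  exact enorm_tsum_le_tsum_enorm

end Gauge

/-! ### Convergence of the convolutions in the small Lebesgue norm -/

section ApproximateIdentity

variable {G : Type*} [AddCommGroup G] [TopologicalSpace G] [IsTopologicalAddGroup G]
  [MeasurableSpace G] [BorelSpace G] [CompactSpace G] {μ : Measure G}
  [μ.IsAddLeftInvariant] [μ.IsNegInvariant] {e u : G → ℝ} {p θ : ℝ}

/-- Convolution with a continuous function commutes with series converging absolutely in `L¹`. -/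
lemma hasSum_groupConv {f : G → ℝ} {u : ℕ → G → ℝ} (he : Continuous e)
    (hu : ∀ k, AEStronglyMeasurable (u k) μ) (hut : ∑' k, eLpNorm (u k) 1 μ ≠ ∞)
    (hs : ∀ᵐ x ∂μ, HasSum (fun k => u k x) (f x)) (x : G) :
    HasSum (fun k => groupConv μ e (u k) x) (groupConv μ e f x) := by
  obtain ⟨C, hC⟩ := isCompact_univ.exists_bound_of_continuousOn he.continuousOn
  have huint (k : ℕ) : Integrable (u k) μ :=
    memLp_one_iff_integrable.1 ⟨hu k, (ENNReal.ne_top_of_tsum_ne_top hut k).lt_top⟩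
  have hint (k : ℕ) := integrable_mul_comp_sub he (huint k) x
  have hsum : Summable fun k => ∫ t, ‖u k t‖ ∂μ := by
    refine (ENNReal.summable_toReal hut).congr fun k => ?_
    rw [eLpNorm_one_eq_lintegral_enorm, integral_norm_eq_lintegral_enorm (hu k)]
  -- Boundedness of `e` reduces termwise integration to summability of the `L¹` norms, at every `x`.
  have hsum' : Summable fun k => ∫ t, ‖e (x - t) * u k t‖ ∂μ := by
    refine (hsum.mul_left C).of_nonneg_of_le (fun k => integral_nonneg fun t => norm_nonneg _)
      fun k => ?_
    rw [← integral_const_mul C fun t => ‖u k t‖]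
    refine integral_mono (hint k).norm ((huint k).norm.const_mul C) fun t => ?_
    simp only [norm_mul]
    exact mul_le_mul_of_nonneg_right (hC _ (Set.mem_univ _)) (norm_nonneg _)
  have h := hasSum_integral_of_summable_integral_norm hint hsum'
  have hf : ∫ t, e (x - t) * f t ∂μ = ∫ t, ∑' k, e (x - t) * u k t ∂μ := by
    refine integral_congr_ae ?_
    filter_upwards [hs] with t ht
    exact (ht.mul_left _).tsum_eq.symm
  simp only [groupConv_eq_swap, hf]
  exact h

variable [IsFiniteMeasure μ]

/-- Triangle inequality and contraction in every `L^q`; this is the domination for the series. -/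
lemma smallLebesgueGauge_groupConv_sub_le (he : Continuous e) (he0 : 0 ≤ e)
    (he1 : ∫ t, e t ∂μ = 1) (hu : Integrable u μ) :
    smallLebesgueGauge p θ μ (groupConv μ e u - u) ≤ 2 * smallLebesgueGauge p θ μ u := by
  refine smallLebesgueGauge_le_const_mul two_ne_zero ENNReal.ofNat_ne_top fun q hq => ?_
  refine (eLpNorm_sub_le (continuous_groupConv he hu).aestronglyMeasurable hu.1 hq).trans ?_
  rw [two_mul]
  gcongr
  exact eLpNorm_groupConv_le he he0 he1 hu.1 hq

/-- The gauge is an infimum, so smallness for a single `ε` with finite conjugate exponent suffices.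
-/
lemma exists_nhds_smallLebesgueGauge_groupConv_sub_le [T2Space G] [μ.Regular] (hp : 1 < p)
    (hu : AEStronglyMeasurable u μ) (hut : smallLebesgueGauge p θ μ u ≠ ∞)
    {δ : ℝ≥0∞} (hδ : δ ≠ 0) :
    ∃ V ∈ 𝓝 (0 : G), ∀ e : G → ℝ, Continuous e → 0 ≤ e → ∫ t, e t ∂μ = 1 →
      Function.support e ⊆ V → smallLebesgueGauge p θ μ (groupConv μ e u - u) ≤ δ := by
  obtain ⟨ε, hε, hqt, hux⟩ := exists_eLpNorm_ne_top_of_smallLebesgueGauge_ne_top hp hu hut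
  have hw : ENNReal.ofReal (ε ^ (-θ / (p - ε))) ≠ 0 := by
    simpa using Real.rpow_pos_of_pos hε.1 _
  obtain ⟨V, hV, h⟩ := exists_nhds_eLpNorm_groupConv_sub_le hu (ENNReal.one_le_conjExponent _)
    hqt hux (ENNReal.div_ne_zero.2 ⟨hδ, ENNReal.ofReal_ne_top⟩ :
      δ / ENNReal.ofReal (ε ^ (-θ / (p - ε))) ≠ 0)
  refine ⟨V, hV, fun e he he0 he1 hes => (smallLebesgueGauge_le hε).trans ?_⟩
  calc _ ≤ ENNReal.ofReal (ε ^ (-θ / (p - ε))) * (δ / ENNReal.ofReal (ε ^ (-θ / (p - ε)))) := by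
        gcongr
        exact h e he he0 he1 hes
    _ = δ := ENNReal.mul_div_cancel hw ENNReal.ofReal_ne_top

/-- Continuous probability densities with supports shrinking to `0` form an approximate identity
of the small Lebesgue space of a compact abelian group. -/
theorem isSmallLebesgueApproxIdentity_of_support_subset [T2Space G] [μ.Regular] (hp : 1 < p)
    (hθ : 0 ≤ θ) {I : Type*} [Preorder I] {e : I → G → ℝ} (he : ∀ i, Continuous (e i))
    (he0 : ∀ i, 0 ≤ e i) (he1 : ∀ i, ∫ t, e i t ∂μ = 1)
    (hes : ∀ V ∈ 𝓝 (0 : G), ∀ᶠ i in atTop, Function.support (e i) ⊆ V) :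
    IsSmallLebesgueApproxIdentity p θ μ e where
  mem i := (he i).memSmallLebesgue hp
  bounded := by
    refine ⟨1, fun i => le_of_eq ?_⟩
    rw [eLpNorm_one_eq_lintegral_enorm, ENNReal.coe_one, ← ENNReal.ofReal_one, ← he1 i,
      ofReal_integral_eq_lintegral_ofReal (he i).integrable_of_compactSpace
        (ae_of_all _ (he0 i))]
    simp only [Real.enorm_of_nonneg (he0 i _)]
  conv_exists f hf i :=
    ae_of_all _ (convolutionExists_of_continuous (he i) (hf.integrable hp hθ))
  conv_mem f hf i := (continuous_groupConv (he i) (hf.integrable hp hθ)).memSmallLebesgue hp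
  tendsto f hf := by
    obtain ⟨u, hu, hs, hut⟩ := hf.exists_decomposition
    have hu1 := tsum_eLpNorm_one_ne_top hp hθ hu hut
    have huint (k : ℕ) : Integrable (u k) μ :=
      memLp_one_iff_integrable.1 ⟨hu k, (ENNReal.ne_top_of_tsum_ne_top hu1 k).lt_top⟩
    have hle (i : I) : smallLebesgueNorm p θ μ (groupConv μ (e i) f - f) ≤
        ∑' k, smallLebesgueGauge p θ μ (groupConv μ (e i) (u k) - u k) := by
      refine smallLebesgueNorm_le_tsum (fun k =>
        (continuous_groupConv (he i) (huint k)).aestronglyMeasurable.sub (hu k)) ?_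
      filter_upwards [hs] with x hx
      exact (hasSum_groupConv (he i) hu hu1 hs x).sub hx
    refine tendsto_of_tendsto_of_tendsto_of_le_of_le tendsto_const_nhds ?_
      (fun _ => zero_le) hle
    refine ENNReal.tendsto_tsum_zero_of_dominated
      (b := fun k => 2 * smallLebesgueGauge p θ μ (u k)) ?_
      (fun i k => smallLebesgueGauge_groupConv_sub_le (he i) (he0 i) (he1 i) (huint k))
      fun k => ?_
    · rw [ENNReal.tsum_mul_left]
      exact ENNReal.mul_ne_top ENNReal.ofNat_ne_top hut
    · rw [ENNReal.tendsto_nhds_zero]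
      intro δ hδ
      obtain ⟨V, hV, h⟩ := exists_nhds_smallLebesgueGauge_groupConv_sub_le hp (hu k)
        (ENNReal.ne_top_of_tsum_ne_top hut k) hδ.ne'
      filter_upwards [hes V hV] with i hi
      exact h (e i) (he i) (he0 i) (he1 i) hi

end ApproximateIdentity

theorem theorem5 {G : Type u} [AddCommGroup G] [TopologicalSpace G] [IsTopologicalAddGroup G]
    [LocallyCompactSpace G] [T2Space G] [MeasurableSpace G] [BorelSpace G]
    (μ : Measure G) [μ.IsAddHaarMeasure] [μ.Regular] [IsFiniteMeasure μ]
    (p θ : ℝ) (hp : 1 < p) (hθ : 0 ≤ θ) :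
    ∃ (I : Type u) (_ : Preorder I) (_ : IsDirectedOrder I) (_ : Nonempty I) (e : I → G → ℝ),
      IsSmallLebesgueApproxIdentity p θ μ e := by
  -- A noncompact locally compact group has infinite Haar measure.
  have : CompactSpace G := by
    by_contra h
    rw [not_compactSpace_iff] at h
    exact measure_ne_top μ Set.univ (measure_univ_of_isAddLeftInvariant μ)
  -- The net is indexed by the open neighbourhoods of `0` under reverse inclusion.
  choose e he he0 he1 hes using fun V : (TopologicalSpace.OpenNhdsOf (0 : G))ᵒᵈ =>
    exists_continuous_density (μ := μ)
      ((OrderDual.ofDual V).isOpen.mem_nhds (OrderDual.ofDual V).mem)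
  refine ⟨(TopologicalSpace.OpenNhdsOf (0 : G))ᵒᵈ, inferInstance, inferInstance, inferInstance, e,
    isSmallLebesgueApproxIdentity_of_support_subset hp hθ he he0 he1 fun V hV => ?_⟩
  obtain ⟨U, hUV, hUo, hU0⟩ := mem_nhds_iff.1 hV
  filter_upwards [eventually_ge_atTop (OrderDual.toDual
    (⟨⟨U, hUo⟩, hU0⟩ : TopologicalSpace.OpenNhdsOf (0 : G)))] with i hi
  exact (hes i).trans (Set.Subset.trans (OrderDual.ofDual_le_ofDual.2 hi) hUV)
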